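/- Let $\tilde H^2$ be the closed subspace of all $f\in L^2[-1/2,1/2]$ with $\int_{-1/2}^{1/2} f(x)e^{-2\pi i n x}\,dx=0$ for every integer $n<0$, and let $P_+:L^2[-1/2,1/2]\to\tilde H^2$ be the orthogonal (Riesz) projection. For $\phi\in L^\infty[-1/2,1/2]$ the Toeplitz operator with symbol $\phi$ is the bounded operator $T_\phi:\tilde H^2\to\tilde H^2$, $T_\phi f=P_+(\phi f)$. A bounded operator $T$ on $\tilde H^2$ is called norm-bounded below if there is $c>0$ with $\|Tf\|\ge c\|f\|$ for all $f\in\tilde H^2$, and invertible if it has a bounded two-sided inverse. Let $\xi\in\mathbb{R}$ and $g_\xi(x)=e^{2\pi i\xi x}$ for $x\in[-1/2,1/2]$. Then: 1. $T_{g_\xi}$ is not injective if $\xi<-1/2$. 2. $T_{g_\xi}$ is invertible if $-1/2<\xi<1/2$. 3. $T_{g_\xi}$ is injective but not norm-bounded below if $\xi=-1/2+n$ for some $n\in\{0,1,2,\dots\}$. 4. $T_{g_\xi}$ is injective and norm-bounded below but not surjective if $\xi>1/2$ and $\xi\neq-1/2+n$ for all $n\in\{0,1,2,\dots\}$. -/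

import Mathlib

open MeasureTheory
open scoped ENNReal

noncomputable section

namespace ToeplitzExp

/-- Lebesgue measure on the interval `[-1/2, 1/2]`. -/
abbrev intervalMeasure : Measure ℝ :=
  volume.restrict (Set.Icc (-(1 / 2) : ℝ) (1 / 2))

/-- The function `g_ξ(x) = e^{2πiξx}` of a real variable. -/
def expFun (ξ : ℝ) (x : ℝ) : ℂ :=
  Complex.exp (2 * Real.pi * Complex.I * ξ * x)

theorem memLp_expFun (p : ℝ≥0∞) (ξ : ℝ) : MemLp (expFun ξ) p intervalMeasure := by
  refine MemLp.of_bound (C := 1) ?_ (Filter.Eventually.of_forall fun x => ?_)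
  · have h : Continuous (expFun ξ) := by
      unfold expFun
      fun_prop
    exact h.aestronglyMeasurable
  · have h : (2 * Real.pi * Complex.I * ξ * x : ℂ)
        = ((2 * Real.pi * ξ * x : ℝ) : ℂ) * Complex.I := by
      push_cast
      ring
    rw [expFun, h, Complex.norm_exp_ofReal_mul_I]

/-- The class of `g_ξ` in `L^p[-1/2, 1/2]`. -/
def expLp (p : ℝ≥0∞) (ξ : ℝ) : Lp ℂ p intervalMeasure :=
  (memLp_expFun p ξ).toLp (expFun ξ)

/-- The Hardy space: all `f` in `L²[-1/2, 1/2]` whose Fourier coefficients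
`⟨f, e^{2πinx}⟩ = ∫ f(x) e^{-2πinx} dx` vanish for every negative integer `n`.
(Mathlib's inner product is conjugate-linear in its first argument.) -/
def hardySpace : Submodule ℂ (Lp ℂ 2 intervalMeasure) where
  carrier := {f | ∀ n : ℤ, n < 0 → inner ℂ (expLp 2 n) f = 0}
  zero_mem' := fun n _ => inner_zero_right _
  add_mem' := fun {f g} hf hg n hn => by
    rw [inner_add_right, hf n hn, hg n hn, add_zero]
  smul_mem' := fun c f hf n hn => by
    rw [inner_smul_right, hf n hn, mul_zero]

theorem isClosed_hardySpace : IsClosed (hardySpace : Set (Lp ℂ 2 intervalMeasure)) := by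
  have h : (hardySpace : Set (Lp ℂ 2 intervalMeasure))
      = ⋂ n : ℤ, ⋂ _ : n < 0, {f | inner ℂ (expLp 2 n) f = 0} := by
    ext f
    simp [hardySpace]
  rw [h]
  exact isClosed_iInter fun n => isClosed_iInter fun _ =>
    isClosed_eq (continuous_const.inner continuous_id) continuous_const

instance instCompleteSpaceHardySpace : CompleteSpace hardySpace :=
  isClosed_hardySpace.completeSpace_coe

/-- Multiplication by `φ ∈ L^∞[-1/2, 1/2]` as a bounded operator on `L²[-1/2, 1/2]`. -/
def mulOp (φ : Lp ℂ ∞ intervalMeasure) :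
    Lp ℂ 2 intervalMeasure →L[ℂ] Lp ℂ 2 intervalMeasure :=
  (ContinuousLinearMap.mul ℂ ℂ).holderL intervalMeasure ∞ 2 2 φ

/-- The Toeplitz operator `T_φ f = P₊(φ f)` on the Hardy space, where `P₊` is the orthogonal
(Riesz) projection of `L²[-1/2, 1/2]` onto the Hardy space. -/
def toeplitz (φ : Lp ℂ ∞ intervalMeasure) : hardySpace →L[ℂ] hardySpace :=
  hardySpace.orthogonalProjectionOnto ∘L mulOp φ ∘L hardySpace.subtypeL

/-- A bounded operator is norm-bounded below if `c ‖f‖ ≤ ‖T f‖` for all `f`, for some `c > 0`. -/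
def NormBoundedBelow {H : Type*} [NormedAddCommGroup H] [NormedSpace ℂ H] (T : H →L[ℂ] H) : Prop :=
  ∃ c : ℝ, 0 < c ∧ ∀ f : H, c * ‖f‖ ≤ ‖T f‖

end ToeplitzExp

end

noncomputable section

namespace ToeplitzExp

/-! For natural n, multiplication by e^{2πinx} preserves the Hardy space and its adjoint preserves
the complement. Hence T_{ξ+n} = T_ξ T_n and T_{ξ-n} = T_{-n} T_ξ (`toeplitz_add_natCast`,
`toeplitz_neg_natCast_add`), with T_n isometric. For |ξ| < 1/2 a Neumann series inverts T_ξ, because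
1 - cos(πξ) g_ξ has sup norm below 1 (`isUnit_toeplitz_expLp`). These factorizations settle every ξ
outside 1/2 + ℤ.

Half-integers need more. T_{-1/2} is injective, since a kernel element f has all Fourier
coefficients of f² zero (`eq_zero_of_mulOp_mem_orthogonal`), while T_{-3/2} kills the boundary
values of (1+z)^{1/2}. T_{-1/2} is a norm limit of the non-injective T_{-1/2-ε}, so it is not
bounded below; this passes to T_{-1/2+n} because the range of T_1 has codimension one
(`normBoundedBelow_of_comp`). -/

/-! ### Exponentials and their multiplication operators -/

theorem expFun_add (ξ η x : ℝ) : expFun (ξ + η) x = expFun ξ x * expFun η x := by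
  rw [expFun, expFun, expFun, ← Complex.exp_add]
  congr 1
  push_cast
  ring

theorem expFun_zero (x : ℝ) : expFun 0 x = 1 := by
  simp [expFun]

theorem expFun_eq_exp_mul_I (ξ x : ℝ) :
    expFun ξ x = Complex.exp ((2 * Real.pi * ξ * x : ℝ) * Complex.I) := by
  rw [expFun]
  congr 1
  push_cast
  ring

theorem conj_expFun (ξ x : ℝ) : starRingEnd ℂ (expFun ξ x) = expFun (-ξ) x := by
  rw [expFun_eq_exp_mul_I, expFun_eq_exp_mul_I, ← Complex.exp_conj]
  congr 1
  simp [map_ofNat]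

theorem norm_expFun (ξ x : ℝ) : ‖expFun ξ x‖ = 1 := by
  rw [expFun_eq_exp_mul_I, Complex.norm_exp_ofReal_mul_I]

theorem continuous_expFun (ξ : ℝ) : Continuous (expFun ξ) := by
  unfold expFun
  fun_prop

theorem coeFn_expLp (p : ℝ≥0∞) (ξ : ℝ) : expLp p ξ =ᵐ[intervalMeasure] expFun ξ :=
  (memLp_expFun p ξ).coeFn_toLp

theorem coeFn_mulOp_expLp (ξ : ℝ) (f : Lp ℂ 2 intervalMeasure) :
    mulOp (expLp ∞ ξ) f =ᵐ[intervalMeasure] fun x => expFun ξ x * f x := by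
  have h := (ContinuousLinearMap.mul ℂ ℂ).coeFn_holder (r := 2) (expLp ∞ ξ) f
  filter_upwards [h, coeFn_expLp ∞ ξ] with x h1 h2
  rw [← h2]
  exact h1

theorem mulOp_expLp_add (ξ η : ℝ) (f : Lp ℂ 2 intervalMeasure) :
    mulOp (expLp ∞ (ξ + η)) f = mulOp (expLp ∞ ξ) (mulOp (expLp ∞ η) f) := by
  apply Lp.ext
  filter_upwards [coeFn_mulOp_expLp (ξ + η) f, coeFn_mulOp_expLp η f,
    coeFn_mulOp_expLp ξ (mulOp (expLp ∞ η) f)] with x h1 h2 h3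
  rw [h1, h3, h2, expFun_add, mul_assoc]

theorem mulOp_expLp_zero (f : Lp ℂ 2 intervalMeasure) : mulOp (expLp ∞ 0) f = f := by
  apply Lp.ext
  filter_upwards [coeFn_mulOp_expLp 0 f] with x h1
  rw [h1, expFun_zero, one_mul]

theorem mulOp_expLp_expLp (ξ η : ℝ) :
    mulOp (expLp ∞ ξ) (expLp 2 η) = expLp 2 (ξ + η) := by
  apply Lp.ext
  filter_upwards [coeFn_mulOp_expLp ξ (expLp 2 η), coeFn_expLp 2 η, coeFn_expLp 2 (ξ + η)]
    with x h1 h2 h3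
  rw [h1, h2, h3, expFun_add]

theorem inner_expLp (ξ : ℝ) (f : Lp ℂ 2 intervalMeasure) :
    inner ℂ (expLp 2 ξ) f = ∫ x, expFun (-ξ) x * f x ∂intervalMeasure := by
  rw [L2.inner_def]
  apply integral_congr_ae
  filter_upwards [coeFn_expLp 2 ξ] with x h
  rw [h, RCLike.inner_apply, conj_expFun, mul_comm]

theorem inner_mulOp_expLp (ξ : ℝ) (f g : Lp ℂ 2 intervalMeasure) :
    inner ℂ f (mulOp (expLp ∞ ξ) g) = inner ℂ (mulOp (expLp ∞ (-ξ)) f) g := by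
  rw [L2.inner_def, L2.inner_def]
  apply integral_congr_ae
  filter_upwards [coeFn_mulOp_expLp ξ g, coeFn_mulOp_expLp (-ξ) f] with x h1 h2
  rw [h1, h2, RCLike.inner_apply, RCLike.inner_apply, map_mul, conj_expFun, neg_neg]
  ring

theorem inner_expLp_mulOp (ξ η : ℝ) (f : Lp ℂ 2 intervalMeasure) :
    inner ℂ (expLp 2 η) (mulOp (expLp ∞ ξ) f) = inner ℂ (expLp 2 (η - ξ)) f := by
  rw [inner_mulOp_expLp, mulOp_expLp_expLp, neg_add_eq_sub]

theorem norm_mulOp_expLp (ξ : ℝ) (f : Lp ℂ 2 intervalMeasure) :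
    ‖mulOp (expLp ∞ ξ) f‖ = ‖f‖ := by
  refine le_antisymm (Lp.norm_le_norm_of_ae_le ?_) (Lp.norm_le_norm_of_ae_le ?_) <;>
  · filter_upwards [coeFn_mulOp_expLp ξ f] with x h1
    rw [h1, norm_mul, norm_expFun, one_mul]

/-- An `L²` bound for a multiplier `a g_ξ - b g_η` from a pointwise bound. -/
theorem norm_smul_sub_smul_mulOp_le (a b : ℂ) (ξ η : ℝ) {C : ℝ}
    (hC : ∀ x ∈ Set.Icc (-(1 / 2) : ℝ) (1 / 2), ‖a * expFun ξ x - b * expFun η x‖ ≤ C)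
    (f : Lp ℂ 2 intervalMeasure) :
    ‖a • mulOp (expLp ∞ ξ) f - b • mulOp (expLp ∞ η) f‖ ≤ C * ‖f‖ := by
  apply Lp.norm_le_mul_norm_of_ae_le_mul
  filter_upwards [coeFn_mulOp_expLp ξ f, coeFn_mulOp_expLp η f,
    Lp.coeFn_sub (a • mulOp (expLp ∞ ξ) f) (b • mulOp (expLp ∞ η) f),
    Lp.coeFn_smul a (mulOp (expLp ∞ ξ) f), Lp.coeFn_smul b (mulOp (expLp ∞ η) f),
    ae_restrict_mem measurableSet_Icc] with x h1 h2 h3 h4 h5 hx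
  rw [h3, Pi.sub_apply, h4, h5, Pi.smul_apply, Pi.smul_apply, h1, h2, smul_eq_mul, smul_eq_mul,
    ← mul_assoc, ← mul_assoc, ← sub_mul, norm_mul]
  exact mul_le_mul_of_nonneg_right (hC x hx) (norm_nonneg _)

/-! ### Integer shifts and factorization -/

theorem toeplitz_apply (φ : Lp ℂ ∞ intervalMeasure) (f : hardySpace) :
    toeplitz φ f = hardySpace.orthogonalProjectionOnto (mulOp φ f) :=
  rfl

theorem mulOp_natCast_mem_hardySpace (n : ℕ) {f : Lp ℂ 2 intervalMeasure} (hf : f ∈ hardySpace) :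
    mulOp (expLp ∞ n) f ∈ hardySpace := by
  intro m hm
  rw [inner_expLp_mulOp]
  have h := hf (m - n) (by omega)
  push_cast at h
  exact h

theorem mulOp_neg_natCast_mem_orthogonal (n : ℕ) {f : Lp ℂ 2 intervalMeasure}
    (hf : f ∈ hardySpaceᗮ) : mulOp (expLp ∞ (-n)) f ∈ hardySpaceᗮ := by
  rw [Submodule.mem_orthogonal] at hf ⊢
  intro u hu
  rw [inner_mulOp_expLp, neg_neg]
  exact hf _ (mulOp_natCast_mem_hardySpace n hu)

theorem coe_toeplitz_natCast (n : ℕ) (f : hardySpace) :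
    (toeplitz (expLp ∞ n) f : Lp ℂ 2 intervalMeasure) = mulOp (expLp ∞ n) f := by
  rw [toeplitz_apply]
  exact congrArg Subtype.val (hardySpace.orthogonalProjectionOnto_mem_subspace_eq_self
    ⟨_, mulOp_natCast_mem_hardySpace n f.2⟩)

theorem norm_toeplitz_natCast (n : ℕ) (f : hardySpace) :
    ‖toeplitz (expLp ∞ n) f‖ = ‖f‖ := by
  rw [Submodule.coe_norm, coe_toeplitz_natCast, norm_mulOp_expLp, Submodule.coe_norm]

theorem toeplitz_add_natCast (ξ : ℝ) (n : ℕ) :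
    toeplitz (expLp ∞ (ξ + n)) = toeplitz (expLp ∞ ξ) ∘L toeplitz (expLp ∞ n) := by
  ext1 f
  rw [ContinuousLinearMap.comp_apply, toeplitz_apply, toeplitz_apply _ (toeplitz _ f),
    coe_toeplitz_natCast, mulOp_expLp_add]

/-- The part of g_ξ f discarded by P₊ stays in the complement after multiplication by g_{-n}, so the
inner projection can be dropped. -/
theorem toeplitz_neg_natCast_add (ξ : ℝ) (n : ℕ) :
    toeplitz (expLp ∞ (-n + ξ)) = toeplitz (expLp ∞ (-n)) ∘L toeplitz (expLp ∞ ξ) := by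
  ext1 f
  rw [ContinuousLinearMap.comp_apply, toeplitz_apply, toeplitz_apply _ (toeplitz _ f),
    mulOp_expLp_add, ← sub_eq_zero, ← map_sub, ← map_sub,
    hardySpace.orthogonalProjectionOnto_eq_zero_iff, toeplitz_apply]
  exact mulOp_neg_natCast_mem_orthogonal n (hardySpace.sub_starProjection_mem_orthogonal _)

/-! ### Orthonormality and completeness of the integer exponentials -/

theorem inner_expLp_expLp_of_ne {m n : ℤ} (h : m ≠ n) :
    inner ℂ (expLp 2 m) (expLp 2 n) = 0 := by
  have h1 : inner ℂ (expLp 2 m) (expLp 2 n)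
      = ∫ x in (-(1 / 2) : ℝ)..(1 / 2), expFun ((n - m : ℤ) : ℝ) x := by
    rw [inner_expLp, intervalIntegral.integral_of_le (by norm_num), ← integral_Icc_eq_integral_Ioc]
    apply integral_congr_ae
    filter_upwards [coeFn_expLp 2 n] with x hx
    rw [hx, ← expFun_add]
    congr 1
    push_cast
    ring
  have hc : (2 * Real.pi * Complex.I * (n - m : ℤ) : ℂ) ≠ 0 := by
    have : ((n - m : ℤ) : ℂ) ≠ 0 := by
      exact_mod_cast sub_ne_zero.mpr h.symm
    exact mul_ne_zero Complex.two_pi_I_ne_zero this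
  rw [h1]
  have h2 : ∀ x : ℝ, expFun ((n - m : ℤ) : ℝ) x
      = Complex.exp ((2 * Real.pi * Complex.I * (n - m : ℤ) : ℂ) * x) := fun x => by
    simp [expFun]
  simp_rw [h2]
  rw [integral_exp_mul_complex hc, div_eq_zero_iff]
  left
  rw [sub_eq_zero, Complex.exp_eq_exp_iff_exists_int]
  refine ⟨n - m, ?_⟩
  push_cast
  ring

theorem inner_expLp_self (ξ : ℝ) : inner ℂ (expLp 2 ξ) (expLp 2 ξ) = 1 := by
  rw [inner_expLp]
  have : ∀ᵐ x ∂intervalMeasure, expFun (-ξ) x * expLp 2 ξ x = 1 := by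
    filter_upwards [coeFn_expLp 2 ξ] with x hx
    rw [hx, ← expFun_add, neg_add_cancel, expFun_zero]
  rw [integral_congr_ae this]
  norm_num

theorem expLp_natCast_mem_hardySpace (n : ℕ) : expLp 2 n ∈ hardySpace := by
  intro m hm
  have h := inner_expLp_expLp_of_ne (m := m) (n := n) (by omega)
  simpa using h

theorem expLp_zero_mem_hardySpace : expLp 2 0 ∈ hardySpace := by
  simpa using expLp_natCast_mem_hardySpace 0

theorem fourier_coe_eq_expFun (n : ℤ) (x : ℝ) :
    fourier n (x : AddCircle (1 : ℝ)) = expFun n x := by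
  rw [fourier_coe_apply, expFun]
  congr 1
  push_cast
  ring

theorem integrable_comp_coe_mul {u : ℝ → ℂ} (hu : Integrable u intervalMeasure)
    (φ : C(AddCircle (1 : ℝ), ℂ)) :
    Integrable (fun x : ℝ => φ x * u x) intervalMeasure :=
  hu.bdd_mul (c := ‖φ‖)
    (φ.continuous.comp (AddCircle.continuous_mk' 1)).aestronglyMeasurable
    (Filter.Eventually.of_forall fun x => φ.norm_coe_le_norm x)

/-- Integration against an integrable function, as a functional on continuous functions on the
circle. -/
def circleFunctional {u : ℝ → ℂ} (hu : Integrable u intervalMeasure) :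
    C(AddCircle (1 : ℝ), ℂ) →L[ℂ] ℂ :=
  LinearMap.mkContinuous
    { toFun := fun φ => ∫ x : ℝ, φ x * u x ∂intervalMeasure
      map_add' := fun φ ψ => by
        rw [← integral_add (integrable_comp_coe_mul hu φ) (integrable_comp_coe_mul hu ψ)]
        simp [add_mul]
      map_smul' := fun c φ => by
        rw [RingHom.id_apply, ← integral_smul]
        simp [mul_assoc] }
    (∫ x, ‖u x‖ ∂intervalMeasure) fun φ => by
      rw [mul_comm, ← integral_const_mul]
      refine norm_integral_le_of_norm_le (hu.norm.const_mul _)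
        (Filter.Eventually.of_forall fun x => ?_)
      rw [norm_mul]
      exact mul_le_mul_of_nonneg_right (φ.norm_coe_le_norm _) (norm_nonneg _)

/-- Trigonometric polynomials are dense in C(circle), and the kernel of a bounded functional is
closed. -/
theorem integral_comp_coe_mul_eq_zero {u : ℝ → ℂ} (hu : Integrable u intervalMeasure)
    (h : ∀ n : ℤ, ∫ x, expFun n x * u x ∂intervalMeasure = 0) (φ : C(AddCircle (1 : ℝ), ℂ)) :
    ∫ x : ℝ, φ x * u x ∂intervalMeasure = 0 := by
  have : Fact (0 < (1 : ℝ)) := ⟨one_pos⟩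
  have hspan : Submodule.span ℂ (Set.range (@fourier (1 : ℝ)))
      ≤ LinearMap.ker (circleFunctional hu).toLinearMap := by
    rw [Submodule.span_le]
    rintro _ ⟨n, rfl⟩
    refine Eq.trans (integral_congr_ae (Filter.Eventually.of_forall fun x => ?_)) (h n)
    exact congrArg (· * u x) (fourier_coe_eq_expFun n x)
  have hcl := Submodule.topologicalClosure_minimal _ hspan (circleFunctional hu).isClosed_ker
  rw [span_fourier_closure_eq_top] at hcl
  exact hcl (Submodule.mem_top (x := φ))

/-- An integrable function on `[-1/2, 1/2]` with vanishing Fourier coefficients is zero. -/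
theorem ae_eq_zero_of_integral_expFun_mul_eq_zero {u : ℝ → ℂ} (hu : Integrable u intervalMeasure)
    (h : ∀ n : ℤ, ∫ x, expFun n x * u x ∂intervalMeasure = 0) :
    u =ᵐ[intervalMeasure] 0 := by
  have : Fact (0 < (1 : ℝ)) := ⟨one_pos⟩
  have key : ∀ᵐ x : ℝ, x ∈ Set.Ioo (-(1 / 2) : ℝ) (1 / 2) → u x = 0 := by
    refine isOpen_Ioo.ae_eq_zero_of_integral_contDiff_smul_eq_zero ?_ ?_
    · exact IntegrableOn.locallyIntegrableOn (IntegrableOn.mono_set hu Set.Ioo_subset_Icc_self)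
    · intro g hg _ hsupp
      have hout : ∀ x, x ∉ Set.Ioo (-(1 / 2) : ℝ) (1 / 2) → g x = 0 := fun x hx =>
        image_eq_zero_of_notMem_tsupport fun h' => hx (hsupp h')
      -- The test function vanishes at both endpoints, so it glues to a continuous function on the
      -- circle.
      have hcont : Continuous (AddCircle.liftIco (1 : ℝ) (-(1 / 2)) fun x => (g x : ℂ)) := by
        apply AddCircle.liftIco_continuous
        · rw [hout _ (by norm_num), hout _ (by norm_num)]
        · exact (Complex.continuous_ofReal.comp hg.continuous).continuousOn
      have h0 := integral_comp_coe_mul_eq_zero hu h ⟨_, hcont⟩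
      rw [integral_Icc_eq_integral_Ioo] at h0
      rw [← h0, ← setIntegral_eq_integral_of_forall_compl_eq_zero
        (s := Set.Ioo (-(1 / 2) : ℝ) (1 / 2)) (fun x hx => by rw [hout x hx, zero_smul])]
      refine setIntegral_congr_fun measurableSet_Ioo fun x hx => ?_
      change g x • u x = AddCircle.liftIco (1 : ℝ) (-(1 / 2)) (fun x => (g x : ℂ)) x * u x
      rw [AddCircle.liftIco_coe_apply ⟨hx.1.le, by linarith [hx.2]⟩, Complex.real_smul]
  rw [Filter.EventuallyEq, intervalMeasure, ← restrict_Ioo_eq_restrict_Icc,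
    ae_restrict_iff' measurableSet_Ioo]
  exact key

theorem eq_zero_of_inner_expLp_eq_zero {f : Lp ℂ 2 intervalMeasure}
    (h : ∀ n : ℤ, inner ℂ (expLp 2 n) f = 0) : f = 0 := by
  rw [Lp.eq_zero_iff_ae_eq_zero]
  refine ae_eq_zero_of_integral_expFun_mul_eq_zero ((Lp.memLp f).integrable (by norm_num))
    fun n => ?_
  have := h (-n)
  rw [inner_expLp] at this
  simpa using this

/-! ### Kernels and injectivity at -1/2 -/

theorem mem_orthogonal_hardySpace {f : Lp ℂ 2 intervalMeasure} :
    f ∈ hardySpaceᗮ ↔ ∀ n : ℕ, inner ℂ (expLp 2 n) f = 0 := by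
  refine ⟨fun h n => (Submodule.mem_orthogonal _ _).1 h _ (expLp_natCast_mem_hardySpace n),
    fun h => ?_⟩
  rw [← hardySpace.orthogonalProjectionOnto_eq_zero_iff, Subtype.ext_iff]
  apply eq_zero_of_inner_expLp_eq_zero
  intro n
  rcases lt_or_ge n 0 with hn | hn
  · exact (hardySpace.orthogonalProjectionOnto f).2 n hn
  · lift n to ℕ using hn
    have h1 := (Submodule.mem_orthogonal _ _).1
      (hardySpace.sub_starProjection_mem_orthogonal f) _ (expLp_natCast_mem_hardySpace n)
    rw [inner_sub_right, h n, zero_sub, neg_eq_zero] at h1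
    exact_mod_cast h1

theorem toeplitz_expLp_eq_zero_iff {ξ : ℝ} {f : hardySpace} :
    toeplitz (expLp ∞ ξ) f = 0 ↔
      ∀ n : ℕ, inner ℂ (expLp 2 (n - ξ)) (f : Lp ℂ 2 intervalMeasure) = 0 := by
  rw [toeplitz_apply, hardySpace.orthogonalProjectionOnto_eq_zero_iff, mem_orthogonal_hardySpace]
  simp_rw [inner_expLp_mulOp]

theorem inner_star_left (f g : Lp ℂ 2 intervalMeasure) :
    inner ℂ (star g) f = ∫ x, f x * g x ∂intervalMeasure := by
  rw [L2.inner_def]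
  apply integral_congr_ae
  filter_upwards [Lp.coeFn_star g] with x h
  rw [h, RCLike.inner_apply, Pi.star_apply, starRingEnd_apply, star_star]

theorem inner_expLp_star (ξ : ℝ) (f : Lp ℂ 2 intervalMeasure) :
    inner ℂ (expLp 2 ξ) (star f) = starRingEnd ℂ (inner ℂ (expLp 2 (-ξ)) f) := by
  rw [inner_expLp, inner_expLp, ← integral_conj]
  apply integral_congr_ae
  filter_upwards [Lp.coeFn_star f] with x h
  rw [h, map_mul, conj_expFun, neg_neg, Pi.star_apply, starRingEnd_apply]

/-- Frequencies ≥ 0 times frequencies > 0 leave no constant term. -/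
theorem integral_mul_eq_zero_of_mem_hardySpace {f g : Lp ℂ 2 intervalMeasure}
    (hf : f ∈ hardySpace) (hg : ∀ n : ℤ, n ≤ 0 → inner ℂ (expLp 2 n) g = 0) :
    ∫ x, f x * g x ∂intervalMeasure = 0 := by
  rw [← inner_star_left]
  refine Submodule.inner_left_of_mem_orthogonal hf (mem_orthogonal_hardySpace.2 fun n => ?_)
  have h := hg (-n) (by omega)
  push_cast at h
  rw [inner_expLp_star, h, map_zero]

theorem integral_mul_eq_zero_of_mem_orthogonal {f g : Lp ℂ 2 intervalMeasure}
    (hf : f ∈ hardySpaceᗮ) (hg : ∀ n : ℤ, 0 < n → inner ℂ (expLp 2 n) g = 0) :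
    ∫ x, f x * g x ∂intervalMeasure = 0 := by
  rw [← inner_star_left]
  refine Submodule.inner_right_of_mem_orthogonal (K := hardySpace) (fun n hn => ?_) hf
  have h := hg (-n) (by omega)
  push_cast at h
  rw [inner_expLp_star, h, map_zero]

/-- Frequencies of f are ≥ 0 and those of h = g_{-1/2} f are < 0. Since f² = g_1 h², it has
frequencies both ≥ 0 and < 0, hence none. -/
theorem eq_zero_of_mulOp_mem_orthogonal {f : Lp ℂ 2 intervalMeasure} (hf : f ∈ hardySpace)
    (h : mulOp (expLp ∞ (-(1 / 2))) f ∈ hardySpaceᗮ) : f = 0 := by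
  have hint : Integrable (fun x => f x * f x) intervalMeasure :=
    (Lp.memLp f).integrable_mul (Lp.memLp f)
  have hzero := ae_eq_zero_of_integral_expFun_mul_eq_zero hint fun m => by
    rcases lt_or_ge 0 m with hm | hm
    · have h1 := integral_mul_eq_zero_of_mem_hardySpace (g := mulOp (expLp ∞ m) f) hf
        fun n hn => by
          have := hf (n - m) (by omega)
          push_cast at this
          rw [inner_expLp_mulOp, this]
      rw [← h1]
      apply integral_congr_ae
      filter_upwards [coeFn_mulOp_expLp m f] with x hx
      rw [hx]
      ring
    · have h1 := integral_mul_eq_zero_of_mem_orthogonal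
        (g := mulOp (expLp ∞ (m + 1 / 2)) f) h fun n hn => by
          -- The second factor is g_{m+1} h, whose n-th coefficient is the (n-m-1)-th of h; this
          -- index is nonnegative as m ≤ 0 < n.
          obtain ⟨k, hk⟩ := Int.eq_ofNat_of_zero_le (a := n - m - 1) (by omega)
          have h2 := mem_orthogonal_hardySpace.1 h k
          rw [inner_expLp_mulOp] at h2 ⊢
          rw [← h2]
          congr 2
          have hk' : (n : ℝ) - m - 1 = k := by exact_mod_cast hk
          rw [← hk']
          ring
      rw [← h1]
      apply integral_congr_ae
      filter_upwards [coeFn_mulOp_expLp (m + 1 / 2) f, coeFn_mulOp_expLp (-(1 / 2)) f]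
        with x hx hx'
      have : (m : ℝ) = -(1 / 2) + (m + 1 / 2) := by ring
      rw [hx, hx', this, expFun_add, ← this]
      ring
  rw [Lp.eq_zero_iff_ae_eq_zero]
  filter_upwards [hzero] with x hx
  exact mul_self_eq_zero.1 hx

theorem injective_toeplitz_neg_half :
    Function.Injective (toeplitz (expLp ∞ (-(1 / 2)))) := by
  rw [injective_iff_map_eq_zero]
  intro f hf
  rw [toeplitz_apply, hardySpace.orthogonalProjectionOnto_eq_zero_iff] at hf
  exact Subtype.ext (eq_zero_of_mulOp_mem_orthogonal f.2 hf)

theorem injective_toeplitz_natCast (n : ℕ) : Function.Injective (toeplitz (expLp ∞ n)) := by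
  rw [injective_iff_map_eq_zero]
  intro f hf
  rw [← norm_eq_zero, ← norm_toeplitz_natCast n, hf, norm_zero]

/-! ### Invertibility for |ξ| < 1/2 -/

/-- With c = cos(πξ) and θ = 2πξx, |θ| ≤ π|ξ| gives cos θ ≥ c, so |1 - c e^{iθ}|² = 1 - 2c cos θ +
c² ≤ 1 - c². -/
theorem norm_one_sub_cos_mul_expFun_le {ξ x : ℝ} (h1 : -(1 / 2) < ξ) (h2 : ξ < 1 / 2)
    (hx : x ∈ Set.Icc (-(1 / 2) : ℝ) (1 / 2)) :
    ‖1 * expFun 0 x - (Real.cos (Real.pi * ξ) : ℂ) * expFun ξ x‖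
      ≤ √(1 - Real.cos (Real.pi * ξ) ^ 2) := by
  have hpi := Real.pi_pos
  have hξ : |ξ| ≤ 1 / 2 := abs_le.2 ⟨h1.le, h2.le⟩
  have hc : 0 ≤ Real.cos (Real.pi * ξ) :=
    Real.cos_nonneg_of_mem_Icc ⟨by nlinarith, by nlinarith⟩
  have hcos : Real.cos (Real.pi * ξ) ≤ Real.cos (2 * Real.pi * ξ * x) := by
    rw [← Real.cos_abs (Real.pi * ξ), ← Real.cos_abs (2 * Real.pi * ξ * x)]
    have hx' : 2 * |x| ≤ 1 := by
      have := abs_le.2 hx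
      linarith
    apply Real.cos_le_cos_of_nonneg_of_le_pi (abs_nonneg _)
    · rw [abs_mul, abs_of_pos hpi]
      nlinarith
    · rw [show 2 * Real.pi * ξ * x = Real.pi * ξ * (2 * x) by ring, abs_mul, abs_mul 2 x, abs_two]
      exact mul_le_of_le_one_right (abs_nonneg _) hx'
  apply Real.le_sqrt_of_sq_le
  rw [expFun_zero, expFun_eq_exp_mul_I, mul_one, Complex.sq_norm, Complex.normSq_apply]
  simp only [Complex.sub_re, Complex.sub_im, Complex.one_re, Complex.one_im, Complex.re_ofReal_mul,
    Complex.im_ofReal_mul, Complex.exp_ofReal_mul_I_re, Complex.exp_ofReal_mul_I_im]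
  nlinarith [Real.sin_sq_add_cos_sq (2 * Real.pi * ξ * x), mul_le_mul_of_nonneg_left hcos hc]

theorem norm_toeplitz_sub_toeplitz_le (a b : ℂ) (ξ η : ℝ) {C : ℝ}
    (hC : ∀ x ∈ Set.Icc (-(1 / 2) : ℝ) (1 / 2), ‖a * expFun ξ x - b * expFun η x‖ ≤ C)
    (f : hardySpace) :
    ‖a • toeplitz (expLp ∞ ξ) f - b • toeplitz (expLp ∞ η) f‖ ≤ C * ‖f‖ := by
  have h : a • toeplitz (expLp ∞ ξ) f - b • toeplitz (expLp ∞ η) f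
      = hardySpace.orthogonalProjectionOnto
        (a • mulOp (expLp ∞ ξ) f - b • mulOp (expLp ∞ η) f) := by
    rw [map_sub, map_smul, map_smul, toeplitz_apply, toeplitz_apply]
  rw [h]
  exact (hardySpace.norm_orthogonalProjectionOnto_apply_le _).trans
    (norm_smul_sub_smul_mulOp_le a b ξ η hC _)

theorem toeplitz_expLp_zero : toeplitz (expLp ∞ 0) = 1 := by
  ext1 f
  apply Subtype.ext
  have h := coe_toeplitz_natCast 0 f
  rw [Nat.cast_zero, mulOp_expLp_zero] at h
  exact h

theorem isUnit_of_isUnit_smul {H : Type*} [NormedAddCommGroup H] [NormedSpace ℂ H] {c : ℂ}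
    {T : H →L[ℂ] H} (h : IsUnit (c • T)) : IsUnit T := by
  obtain ⟨U, hU⟩ := h
  refine ⟨⟨T, c • ↑U⁻¹, ?_, ?_⟩, rfl⟩
  · rw [mul_smul_comm, ← smul_mul_assoc, ← hU, U.mul_inv]
  · rw [smul_mul_assoc, ← mul_smul_comm, ← hU, U.inv_mul]

theorem isUnit_toeplitz_expLp {ξ : ℝ} (h1 : -(1 / 2) < ξ) (h2 : ξ < 1 / 2) :
    IsUnit (toeplitz (expLp ∞ ξ)) := by
  have hpi := Real.pi_pos
  have hc : 0 < Real.cos (Real.pi * ξ) :=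
    Real.cos_pos_of_mem_Ioo ⟨by nlinarith, by nlinarith⟩
  have hnorm : ‖1 - (Real.cos (Real.pi * ξ) : ℂ) • toeplitz (expLp ∞ ξ)‖ < 1 := by
    refine (ContinuousLinearMap.opNorm_le_bound _ (Real.sqrt_nonneg _) fun f => ?_).trans_lt
      (?_ : √(1 - Real.cos (Real.pi * ξ) ^ 2) < 1)
    · have h := norm_toeplitz_sub_toeplitz_le 1 _ 0 ξ
        (fun x hx => norm_one_sub_cos_mul_expFun_le h1 h2 hx) f
      rwa [toeplitz_expLp_zero, one_smul] at h
    · rw [Real.sqrt_lt' one_pos]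
      nlinarith [pow_pos hc 2]
  have hu := isUnit_one_sub_of_norm_lt_one (R := hardySpace →L[ℂ] hardySpace) hnorm
  rw [sub_sub_cancel] at hu
  exact isUnit_of_isUnit_smul hu

theorem normBoundedBelow_of_isUnit {H : Type*} [NormedAddCommGroup H] [NormedSpace ℂ H]
    {T : H →L[ℂ] H} (hT : IsUnit T) : NormBoundedBelow T := by
  obtain ⟨U, rfl⟩ := hT
  refine ⟨(‖(↑U⁻¹ : H →L[ℂ] H)‖ + 1)⁻¹, by positivity, fun f => ?_⟩
  rw [inv_mul_le_iff₀ (by positivity)]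
  have h : (↑U⁻¹ : H →L[ℂ] H) ((U : H →L[ℂ] H) f) = f := by
    change ((↑U⁻¹ : H →L[ℂ] H) * (U : H →L[ℂ] H)) f = f
    rw [Units.inv_mul]
    rfl
  calc ‖f‖ = ‖(↑U⁻¹ : H →L[ℂ] H) ((U : H →L[ℂ] H) f)‖ := by rw [h]
    _ ≤ ‖(↑U⁻¹ : H →L[ℂ] H)‖ * ‖(U : H →L[ℂ] H) f‖ := ContinuousLinearMap.le_opNorm _ _
    _ ≤ _ := by gcongr; linarith

theorem bijective_of_isUnit {H : Type*} [NormedAddCommGroup H] [NormedSpace ℂ H]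
    {T : H →L[ℂ] H} (hT : IsUnit T) : Function.Bijective T := by
  obtain ⟨U, rfl⟩ := hT
  exact (ContinuousLinearEquiv.ofUnit U).bijective

theorem expLp_zero_ne_zero : expLp 2 0 ≠ 0 := fun h => by
  have := inner_expLp_self 0
  rw [h, inner_zero_right] at this
  exact zero_ne_one this

/-- Everything in the range has zero mean, so the constant 1 is missed. -/
theorem not_surjective_toeplitz_natCast {n : ℕ} (hn : 0 < n) :
    ¬ Function.Surjective (toeplitz (expLp ∞ n)) := by
  intro h
  obtain ⟨f, hf⟩ := h ⟨expLp 2 0, expLp_zero_mem_hardySpace⟩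
  have h1 : mulOp (expLp ∞ n) f = expLp 2 0 := by
    rw [← coe_toeplitz_natCast, hf]
  have h2 := inner_expLp_self 0
  nth_rw 2 [← h1] at h2
  rw [inner_expLp_mulOp] at h2
  have h3 := f.2 (-n) (by omega)
  push_cast at h3
  rw [zero_sub, h3] at h2
  exact zero_ne_one h2

/-! ### A kernel element for ξ = -3/2 -/

/-- The boundary function `x ↦ (1 + e^{2πix})^{1/2}`. -/
def sqrtOneAdd (x : ℝ) : ℂ :=
  (1 + expFun 1 x) ^ (1 / 2 : ℂ)

/-- The branch point z = -1 is included: the positive exponent gives continuity there. -/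
theorem continuousAt_one_add_cpow_half {z : ℂ} (hz : ‖z‖ ≤ 1) :
    ContinuousAt (fun z : ℂ => (1 + z) ^ (1 / 2 : ℂ)) z := by
  have hre : 0 ≤ (1 + z).re := by
    have := (abs_le.1 ((Complex.abs_re_le_norm z).trans hz)).1
    rw [Complex.add_re, Complex.one_re]
    linarith
  exact (Complex.continuousAt_cpow_const_of_re_pos (Or.inl hre) (by norm_num)).comp
    (f := fun z : ℂ => 1 + z) (by fun_prop)

theorem continuous_sqrtOneAdd : Continuous sqrtOneAdd := by
  rw [continuous_iff_continuousAt]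
  intro x
  exact (continuousAt_one_add_cpow_half (norm_expFun 1 x).le).comp
    (f := expFun 1) (continuous_expFun 1).continuousAt

theorem memLp_sqrtOneAdd : MemLp sqrtOneAdd 2 intervalMeasure := by
  obtain ⟨C, hC⟩ := isCompact_Icc.exists_bound_of_continuousOn
    (s := Set.Icc (-(1 / 2) : ℝ) (1 / 2)) continuous_sqrtOneAdd.continuousOn
  refine MemLp.of_bound continuous_sqrtOneAdd.aestronglyMeasurable C ?_
  filter_upwards [ae_restrict_mem measurableSet_Icc] with x hx
  exact hC x hx

theorem sqrtOneAdd_eq {x : ℝ} (hx : x ∈ Set.Ioo (-(1 / 2) : ℝ) (1 / 2)) :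
    sqrtOneAdd x = Complex.exp (Real.log (2 * Real.cos (Real.pi * x)) / 2) * expFun (1 / 4) x := by
  have hpi := Real.pi_pos
  have hcos : 0 < 2 * Real.cos (Real.pi * x) :=
    mul_pos two_pos (Real.cos_pos_of_mem_Ioo ⟨by nlinarith [hx.1], by nlinarith [hx.2]⟩)
  have h1 : 1 + expFun 1 x
      = (2 * Real.cos (Real.pi * x) : ℝ) * Complex.exp ((Real.pi * x : ℝ) * Complex.I) := by
    have h2 : expFun 1 x = Complex.exp ((Real.pi * x : ℝ) * Complex.I)
        * Complex.exp ((Real.pi * x : ℝ) * Complex.I) := by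
      rw [← Complex.exp_add, expFun]
      congr 1
      push_cast
      ring
    have h3 : Complex.exp (-((Real.pi * x : ℝ)) * Complex.I)
        * Complex.exp ((Real.pi * x : ℝ) * Complex.I) = 1 := by
      rw [← Complex.exp_add, neg_mul, neg_add_cancel, Complex.exp_zero]
    rw [h2, Complex.ofReal_mul 2, Complex.ofReal_cos, Complex.ofReal_ofNat, Complex.two_cos,
      add_mul, h3, add_comm]
  have h4 : Complex.log (1 + expFun 1 x)
      = Real.log (2 * Real.cos (Real.pi * x)) + (Real.pi * x : ℝ) * Complex.I := by
    rw [h1, Complex.log_ofReal_mul hcos (Complex.exp_ne_zero _), Complex.log_exp]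
    · rw [Complex.im_ofReal_mul, Complex.I_im]
      nlinarith [hx.1]
    · rw [Complex.im_ofReal_mul, Complex.I_im]
      nlinarith [hx.2]
  have h5 : 1 + expFun 1 x ≠ 0 := by
    rw [h1]
    exact mul_ne_zero (Complex.ofReal_ne_zero.2 hcos.ne') (Complex.exp_ne_zero _)
  rw [sqrtOneAdd, Complex.cpow_def_of_ne_zero h5, h4, expFun, ← Complex.exp_add]
  congr 1
  push_cast
  ring

/-- The modulus is even and the phase is g_{1/4}, so reflection multiplies by g_{-1/2}. -/
theorem sqrtOneAdd_neg {x : ℝ} (hx : x ∈ Set.Ioo (-(1 / 2) : ℝ) (1 / 2)) :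
    sqrtOneAdd (-x) = expFun (-(1 / 2)) x * sqrtOneAdd x := by
  rw [sqrtOneAdd_eq hx, sqrtOneAdd_eq ⟨by linarith [hx.2], by linarith [hx.1]⟩, mul_neg,
    Real.cos_neg, mul_left_comm, ← expFun_add]
  congr 1
  rw [expFun, expFun]
  congr 1
  push_cast
  ring

theorem diffContOnCl_pow_mul_cpow (k : ℕ) :
    DiffContOnCl ℂ (fun z : ℂ => z ^ k * (1 + z) ^ (1 / 2 : ℂ)) (Metric.ball 0 1) := by
  refine ⟨fun z hz => ?_, fun z hz => ?_⟩
  · have h : 1 + z ∈ Complex.slitPlane := by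
      rw [mem_ball_zero_iff] at hz
      exact Complex.mem_slitPlane_of_norm_lt_one hz
    exact ((differentiableAt_id.pow k).mul
      (((differentiableAt_const 1).add differentiableAt_id).cpow_const h)).differentiableWithinAt
  · rw [closure_ball _ one_ne_zero, mem_closedBall_zero_iff] at hz
    exact ((continuousAt_id.pow k).mul (continuousAt_one_add_cpow_half hz)).continuousWithinAt

/-- Cauchy's theorem for z^k (1+z)^{1/2} on the unit circle; dz = iz dθ supplies the extra 1 in the
exponent. -/
theorem integral_expFun_mul_sqrtOneAdd (k : ℕ) :
    ∫ x, expFun (k + 1) x * sqrtOneAdd x ∂intervalMeasure = 0 := by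
  have hC := (diffContOnCl_pow_mul_cpow k).circleIntegral_eq_zero zero_le_one
  rw [circleIntegral] at hC
  set G : ℝ → ℂ := fun θ => deriv (circleMap 0 1) θ •
    (circleMap 0 1 θ ^ k * (1 + circleMap 0 1 θ) ^ (1 / 2 : ℂ)) with hG
  have hper : Function.Periodic G (2 * Real.pi) := fun θ => by
    simp only [hG, deriv_circleMap, periodic_circleMap 0 1 θ]
  have h0 : ∫ θ in (2 * Real.pi * -(1 / 2))..(2 * Real.pi * (1 / 2)), G θ = 0 := by
    have h := hper.intervalIntegral_add_eq (2 * Real.pi * -(1 / 2)) 0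
    rw [zero_add, hC] at h
    rw [← h]
    congr 1
    ring
  have h1 : ∀ x : ℝ, expFun (k + 1) x * sqrtOneAdd x = Complex.I⁻¹ * G (2 * Real.pi * x) := by
    intro x
    have hx : circleMap 0 1 (2 * Real.pi * x) = expFun 1 x := by
      rw [circleMap, expFun_eq_exp_mul_I]
      simp
    have hk : expFun (k + 1) x = expFun 1 x ^ k * expFun 1 x := by
      rw [expFun_add, expFun, expFun, ← Complex.exp_nat_mul]
      congr 2
      push_cast
      ring
    simp only [hG, deriv_circleMap, hx, smul_eq_mul, hk, sqrtOneAdd]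
    field_simp
  rw [integral_Icc_eq_integral_Ioc, ← intervalIntegral.integral_of_le (by norm_num)]
  simp_rw [h1]
  rw [intervalIntegral.integral_const_mul,
    intervalIntegral.integral_comp_mul_left G (by positivity), h0, smul_zero, mul_zero]

/-- Reflecting x turns this into the Cauchy integral, since k + 3/2 - 1/2 = k + 1. -/
theorem integral_expFun_neg_mul_sqrtOneAdd (k : ℕ) :
    ∫ x, expFun (-(k + 3 / 2)) x * sqrtOneAdd x ∂intervalMeasure = 0 := by
  rw [← integral_expFun_mul_sqrtOneAdd k, integral_Icc_eq_integral_Ioc,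
    integral_Icc_eq_integral_Ioo, ← intervalIntegral.integral_of_le (by norm_num)]
  have h := intervalIntegral.integral_comp_neg (a := -(1 / 2)) (b := 1 / 2)
    (fun x => expFun (-(k + 3 / 2)) x * sqrtOneAdd x)
  rw [neg_neg] at h
  rw [← h, intervalIntegral.integral_of_le (by norm_num), integral_Ioc_eq_integral_Ioo]
  refine setIntegral_congr_fun measurableSet_Ioo fun x hx => ?_
  have h1 : expFun (-(k + 3 / 2)) (-x) = expFun (k + 3 / 2) x := by
    rw [expFun, expFun]
    congr 1
    push_cast
    ring
  have h2 : (k + 1 : ℝ) = k + 3 / 2 + -(1 / 2) := by ring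
  rw [h1, sqrtOneAdd_neg hx, ← mul_assoc, ← expFun_add, ← h2]

theorem inner_expLp_toLp_sqrtOneAdd (ξ : ℝ) :
    inner ℂ (expLp 2 ξ) (memLp_sqrtOneAdd.toLp sqrtOneAdd)
      = ∫ x, expFun (-ξ) x * sqrtOneAdd x ∂intervalMeasure := by
  rw [inner_expLp]
  apply integral_congr_ae
  filter_upwards [memLp_sqrtOneAdd.coeFn_toLp] with x hx
  rw [hx]

theorem toLp_sqrtOneAdd_mem_hardySpace :
    memLp_sqrtOneAdd.toLp sqrtOneAdd ∈ hardySpace := by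
  intro n hn
  obtain ⟨k, hk⟩ := Int.eq_ofNat_of_zero_le (a := -n - 1) (by omega)
  have hk' : -(n : ℝ) = k + 1 := by
    have : -(n : ℝ) - 1 = k := by exact_mod_cast hk
    linarith
  rw [inner_expLp_toLp_sqrtOneAdd, hk', integral_expFun_mul_sqrtOneAdd]

theorem toLp_sqrtOneAdd_ne_zero : memLp_sqrtOneAdd.toLp sqrtOneAdd ≠ 0 := by
  intro h
  have hμ : intervalMeasure ≠ 0 := fun h0 => by
    have := congrArg (fun μ : Measure ℝ => μ Set.univ) h0
    norm_num at this
  have := ae_neBot.2 hμ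
  have hae : ∀ᵐ x ∂intervalMeasure, x ∈ Set.Ioo (-(1 / 2) : ℝ) (1 / 2) := by
    rw [intervalMeasure, ← restrict_Ioo_eq_restrict_Icc]
    exact ae_restrict_mem measurableSet_Ioo
  obtain ⟨x, h1, h2, hx⟩ := ((Lp.eq_zero_iff_ae_eq_zero.1 h).and
    (memLp_sqrtOneAdd.coeFn_toLp.and hae)).exists
  rw [h2, sqrtOneAdd_eq hx] at h1
  exact mul_ne_zero (Complex.exp_ne_zero _) (Complex.exp_ne_zero _) h1

/-! ### Failure of injectivity for ξ < -1/2 -/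

theorem not_injective_toeplitz_neg_three_halves :
    ¬ Function.Injective (toeplitz (expLp ∞ (-(3 / 2)))) := by
  intro h
  have h0 : toeplitz (expLp ∞ (-(3 / 2))) ⟨_, toLp_sqrtOneAdd_mem_hardySpace⟩ = 0 := by
    rw [toeplitz_expLp_eq_zero_iff]
    intro k
    rw [sub_neg_eq_add, inner_expLp_toLp_sqrtOneAdd, integral_expFun_neg_mul_sqrtOneAdd]
  have h1 := (injective_iff_map_eq_zero _).1 h _ h0
  exact toLp_sqrtOneAdd_ne_zero (congrArg Subtype.val h1)

theorem not_injective_toeplitz_neg_natCast {n : ℕ} (hn : 0 < n) :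
    ¬ Function.Injective (toeplitz (expLp ∞ (-n))) := by
  intro h
  have h0 : toeplitz (expLp ∞ (-n)) ⟨_, expLp_zero_mem_hardySpace⟩ = 0 := by
    rw [toeplitz_expLp_eq_zero_iff]
    intro k
    have := inner_expLp_expLp_of_ne (m := k + n) (n := 0) (by omega)
    push_cast at this ⊢
    rwa [sub_neg_eq_add]
  have h1 := congrArg Subtype.val ((injective_iff_map_eq_zero _).1 h _ h0)
  exact expLp_zero_ne_zero h1

theorem not_injective_toeplitz_of_lt {ξ : ℝ} (hξ : ξ < -(1 / 2)) :
    ¬ Function.Injective (toeplitz (expLp ∞ ξ)) := by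
  -- This is the least n with ξ + n ≥ -1/2, so ξ + n lies in [-1/2, 1/2).
  obtain ⟨n, hn⟩ : ∃ n : ℕ, (n : ℤ) = ⌈-ξ - 1 / 2⌉ :=
    Int.eq_ofNat_of_zero_le (Int.ceil_nonneg (by linarith)) |>.imp fun _ => Eq.symm
  have hlt : (n : ℝ) < -ξ - 1 / 2 + 1 := by
    have := Int.ceil_lt_add_one (-ξ - 1 / 2)
    rw [← hn] at this
    exact_mod_cast this
  have hle : -ξ - 1 / 2 ≤ n := by
    have := Int.le_ceil (-ξ - 1 / 2)
    rw [← hn] at this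
    exact_mod_cast this
  have hpos : 0 < n := by
    have : (0 : ℝ) < n := by linarith
    exact_mod_cast this
  intro hinj
  rcases hle.lt_or_eq with h | h
  · have h1 := toeplitz_neg_natCast_add (ξ + n) n
    rw [neg_add_cancel_comm_assoc] at h1
    rw [h1, ContinuousLinearMap.coe_comp] at hinj
    exact not_injective_toeplitz_neg_natCast hpos
      (hinj.of_comp_right (bijective_of_isUnit
        (isUnit_toeplitz_expLp (by linarith) (by linarith))).2)
  -- Here ξ + n = -1/2, where invertibility is unavailable; stopping one shift earlier, at -3/2,
  -- gives a right factor that already has a kernel.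
  · obtain ⟨m, rfl⟩ : ∃ m, n = m + 1 := ⟨n - 1, by omega⟩
    have h1 := toeplitz_neg_natCast_add (-(3 / 2)) m
    have h2 : -(m : ℝ) + -(3 / 2) = ξ := by
      push_cast at h
      linarith
    rw [h2] at h1
    rw [h1, ContinuousLinearMap.coe_comp] at hinj
    exact not_injective_toeplitz_neg_three_halves hinj.of_comp

/-! ### Lower bounds at -1/2 + n -/

theorem normBoundedBelow_iff_antilipschitz {H : Type*} [NormedAddCommGroup H] [NormedSpace ℂ H]
    {T : H →L[ℂ] H} : NormBoundedBelow T ↔ ∃ K, AntilipschitzWith K T := by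
  constructor
  · rintro ⟨c, hc, h⟩
    refine ⟨⟨c⁻¹, by positivity⟩, AddMonoidHomClass.antilipschitz_of_bound T fun f => ?_⟩
    exact (le_inv_mul_iff₀ hc).2 (h f)
  · rintro ⟨K, hK⟩
    refine ⟨((K : ℝ) + 1)⁻¹, by positivity, fun f => ?_⟩
    rw [inv_mul_le_iff₀ (by positivity)]
    have h := ZeroHomClass.bound_of_antilipschitz T hK f
    nlinarith [norm_nonneg (T f)]

/-- An injective operator that is bounded below on a subspace of codimension at most one is
bounded below. -/
theorem normBoundedBelow_of_comp {H : Type*} [NormedAddCommGroup H] [NormedSpace ℂ H]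
    [CompleteSpace H] {A S : H →L[ℂ] H} (hA : Function.Injective A)
    (hAS : NormBoundedBelow (A ∘L S)) (v : H) (hv : ∀ f, ∃ g, ∃ c : ℂ, f = S g + c • v) :
    NormBoundedBelow A := by
  obtain ⟨K, hK⟩ := normBoundedBelow_iff_antilipschitz.1 hAS
  have hcl : IsClosed ((LinearMap.range (A ∘L S).toLinearMap : Submodule ℂ H) : Set H) :=
    hK.isClosed_range (A ∘L S).uniformContinuous
  -- The range of A is the closed range of A ∘ S plus a line, hence closed; the open mapping theorem
  -- then gives the bound.
  have hsup := Submodule.isClosed_sup_finiteDimensional _ (ℂ ∙ A v) hcl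
  have hrange : Set.range A
      = ((LinearMap.range (A ∘L S).toLinearMap ⊔ (ℂ ∙ A v) : Submodule ℂ H) : Set H) := by
    ext y
    rw [SetLike.mem_coe, Submodule.mem_sup]
    constructor
    · rintro ⟨f, rfl⟩
      obtain ⟨g, c, rfl⟩ := hv f
      refine ⟨A (S g), ⟨g, rfl⟩, c • A v,
        Submodule.smul_mem _ _ (Submodule.mem_span_singleton_self _), ?_⟩
      rw [map_add, map_smul]
    · rintro ⟨_, ⟨g, rfl⟩, z, hz, rfl⟩
      obtain ⟨c, rfl⟩ := Submodule.mem_span_singleton.1 hz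
      refine ⟨S g + c • v, ?_⟩
      rw [map_add, map_smul]
      rfl
  rw [← hrange] at hsup
  exact normBoundedBelow_iff_antilipschitz.2
    (A.antilipschitz_of_injective_of_isClosed_range hA hsup)

/-- Subtract the mean of f, then divide by e^{2πix}. -/
theorem exists_eq_shift_add (f : hardySpace) :
    ∃ g, ∃ c : ℂ, f = toeplitz (expLp ∞ ((1 : ℕ) : ℝ)) g
      + c • (⟨_, expLp_zero_mem_hardySpace⟩ : hardySpace) := by
  set c := inner ℂ (expLp 2 0) (f : Lp ℂ 2 intervalMeasure) with hc
  have hmem : mulOp (expLp ∞ (-1)) ((f : Lp ℂ 2 intervalMeasure) - c • expLp 2 0)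
      ∈ hardySpace := by
    intro n hn
    rw [inner_expLp_mulOp, inner_sub_right, inner_smul_right, sub_neg_eq_add]
    rcases (show n ≤ -1 by omega).lt_or_eq with h | rfl
    · have h1 := f.2 (n + 1) (by omega)
      have h2 := inner_expLp_expLp_of_ne (m := n + 1) (n := 0) (by omega)
      push_cast at h1 h2
      rw [h1, h2, mul_zero, sub_zero]
    · push_cast
      rw [neg_add_cancel, inner_expLp_self, mul_one, sub_self]
  refine ⟨⟨_, hmem⟩, c, Subtype.ext ?_⟩
  rw [Submodule.coe_add, coe_toeplitz_natCast, Submodule.coe_smul, Nat.cast_one,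
    ← mulOp_expLp_add, add_neg_cancel, mulOp_expLp_zero, sub_add_cancel]

theorem norm_expFun_sub_expFun_le {ε x : ℝ} (ξ : ℝ) (hε : 0 ≤ ε)
    (hx : x ∈ Set.Icc (-(1 / 2) : ℝ) (1 / 2)) :
    ‖1 * expFun ξ x - 1 * expFun (ξ - ε) x‖ ≤ Real.pi * ε := by
  have h1 : (1 : ℂ) * expFun ξ x - 1 * expFun (ξ - ε) x
      = expFun (ξ - ε) x * (expFun ε x - 1) := by
    rw [mul_sub, ← expFun_add, sub_add_cancel]
    ring
  rw [h1, norm_mul, norm_expFun, one_mul, expFun_eq_exp_mul_I, mul_comm]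
  refine Real.norm_exp_I_mul_ofReal_sub_one_le.trans ?_
  have hx' : 2 * |x| ≤ 1 := by
    have := abs_le.2 hx
    linarith
  rw [Real.norm_eq_abs, show 2 * Real.pi * ε * x = Real.pi * ε * (2 * x) by ring, abs_mul,
    abs_mul 2 x, abs_two, abs_of_nonneg (mul_nonneg Real.pi_pos.le hε)]
  exact mul_le_of_le_one_right (mul_nonneg Real.pi_pos.le hε) hx'

theorem not_normBoundedBelow_toeplitz_neg_half :
    ¬ NormBoundedBelow (toeplitz (expLp ∞ (-(1 / 2)))) := by
  rintro ⟨c, hc, h⟩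
  have hpi := Real.pi_pos
  -- Makes the perturbation bound πε equal to c/2, below the assumed lower bound c.
  set ε := c / (2 * Real.pi) with hε
  have hε0 : 0 < ε := by positivity
  have hni := not_injective_toeplitz_of_lt (ξ := -(1 / 2) - ε) (by linarith)
  rw [injective_iff_map_eq_zero] at hni
  push Not at hni
  obtain ⟨f, hf, hf0⟩ := hni
  have h1 := norm_toeplitz_sub_toeplitz_le 1 1 (-(1 / 2)) (-(1 / 2) - ε)
    (fun x hx => norm_expFun_sub_expFun_le _ hε0.le hx) f
  rw [hf, smul_zero, sub_zero, one_smul] at h1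
  have h2 : Real.pi * ε = c / 2 := by
    rw [hε]
    field_simp
  rw [h2] at h1
  have := norm_pos_iff.2 hf0
  nlinarith [h f]

theorem injective_toeplitz_neg_half_add (n : ℕ) :
    Function.Injective (toeplitz (expLp ∞ (-(1 / 2) + n))) := by
  rw [toeplitz_add_natCast, ContinuousLinearMap.coe_comp]
  exact injective_toeplitz_neg_half.comp (injective_toeplitz_natCast n)

theorem not_normBoundedBelow_toeplitz_neg_half_add (n : ℕ) :
    ¬ NormBoundedBelow (toeplitz (expLp ∞ (-(1 / 2) + n))) := by
  induction n with
  | zero =>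
    rw [Nat.cast_zero, add_zero]
    exact not_normBoundedBelow_toeplitz_neg_half
  | succ n ih =>
    intro h
    have h1 := toeplitz_add_natCast (-(1 / 2) + n) 1
    rw [add_assoc, ← Nat.cast_add] at h1
    rw [h1] at h
    exact ih (normBoundedBelow_of_comp (injective_toeplitz_neg_half_add n) h _ exists_eq_shift_add)

/-! ### Reduction for ξ > 1/2 -/

theorem exists_natCast_add_of_half_lt {ξ : ℝ} (h : 1 / 2 < ξ) (hne : ∀ n : ℕ, ξ ≠ -(1 / 2) + n) :
    ∃ (n : ℕ) (α : ℝ), 0 < n ∧ -(1 / 2) < α ∧ α < 1 / 2 ∧ ξ = α + n := by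
  have h1 := Nat.floor_le (a := ξ + 1 / 2) (by linarith)
  have h2 := Nat.lt_floor_add_one (ξ + 1 / 2)
  have h3 := hne ⌊ξ + 1 / 2⌋₊
  refine ⟨⌊ξ + 1 / 2⌋₊, ξ - ⌊ξ + 1 / 2⌋₊, Nat.floor_pos.2 (by linarith), ?_, by linarith, by ring⟩
  -- The floor only gives α ≥ -1/2; equality is the excluded case.
  refine lt_of_le_of_ne (by linarith) fun h4 => h3 (by linarith)

theorem normBoundedBelow_toeplitz_add_natCast {α : ℝ} (h1 : -(1 / 2) < α) (h2 : α < 1 / 2)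
    (n : ℕ) : NormBoundedBelow (toeplitz (expLp ∞ (α + n))) := by
  obtain ⟨c, hc, h⟩ := normBoundedBelow_of_isUnit (isUnit_toeplitz_expLp h1 h2)
  refine ⟨c, hc, fun f => ?_⟩
  rw [toeplitz_add_natCast, ContinuousLinearMap.comp_apply, ← norm_toeplitz_natCast n f]
  exact h _

end ToeplitzExp

end

theorem mainTheorem4 (ξ : ℝ) :
    (ξ < -(1 / 2) →
      ¬ Function.Injective (ToeplitzExp.toeplitz (ToeplitzExp.expLp ∞ ξ))) ∧
    (-(1 / 2) < ξ → ξ < 1 / 2 →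
      IsUnit (ToeplitzExp.toeplitz (ToeplitzExp.expLp ∞ ξ))) ∧
    ((∃ n : ℕ, ξ = -(1 / 2) + n) →
      Function.Injective (ToeplitzExp.toeplitz (ToeplitzExp.expLp ∞ ξ)) ∧
      ¬ ToeplitzExp.NormBoundedBelow (ToeplitzExp.toeplitz (ToeplitzExp.expLp ∞ ξ))) ∧
    (1 / 2 < ξ → (∀ n : ℕ, ξ ≠ -(1 / 2) + n) →
      Function.Injective (ToeplitzExp.toeplitz (ToeplitzExp.expLp ∞ ξ)) ∧
      ToeplitzExp.NormBoundedBelow (ToeplitzExp.toeplitz (ToeplitzExp.expLp ∞ ξ)) ∧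
      ¬ Function.Surjective (ToeplitzExp.toeplitz (ToeplitzExp.expLp ∞ ξ))) := by
  refine ⟨ToeplitzExp.not_injective_toeplitz_of_lt, ToeplitzExp.isUnit_toeplitz_expLp, ?_, ?_⟩
  · rintro ⟨n, rfl⟩
    exact ⟨ToeplitzExp.injective_toeplitz_neg_half_add n,
      ToeplitzExp.not_normBoundedBelow_toeplitz_neg_half_add n⟩
  · intro h hne
    obtain ⟨n, α, hn, h1, h2, rfl⟩ := ToeplitzExp.exists_natCast_add_of_half_lt h hne
    have hb := ToeplitzExp.bijective_of_isUnit (ToeplitzExp.isUnit_toeplitz_expLp h1 h2)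
    refine ⟨?_, ToeplitzExp.normBoundedBelow_toeplitz_add_natCast h1 h2 n, ?_⟩
    · rw [ToeplitzExp.toeplitz_add_natCast, ContinuousLinearMap.coe_comp]
      exact hb.1.comp (ToeplitzExp.injective_toeplitz_natCast n)
    · rw [ToeplitzExp.toeplitz_add_natCast, ContinuousLinearMap.coe_comp]
      exact fun hs => ToeplitzExp.not_surjective_toeplitz_natCast hn (hs.of_comp_left hb.1)
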